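/- **Arveson's dilation theorem for the polydisc.** Let $d\ge 0$ be an integer, let $H$ be a complex Hilbert space, and let $T=(T_1,\dots,T_d)$ be a $d$-tuple of commuting contractions on $H$. Then the following are equivalent. 1. $T$ has a unitary dilation: there are a Hilbert space $K\supseteq H$ and commuting unitaries $U_1,\dots,U_d\in B(K)$ such that $$T_1^{n_1}\cdots T_d^{n_d}=P_H\,U_1^{n_1}\cdots U_d^{n_d}\big|_H\qquad\text{for all }(n_1,\dots,n_d)\in\mathbb{N}^d .$$ 2. The closed polydisc $\overline{\mathbb{D}}^d=\{z\in\mathbb{C}^d:|z_i|\le 1\text{ for all }i\}$ is a complete spectral set for $T$: it contains the joint spectrum $\sigma(T)$, and for every $m$ and every $m\times m$ matrix $f=(f_{ij})$ of rational functions in $d$ variables that are regular on $\overline{\mathbb{D}}^d$, $$\|f(T)\|\le\sup_{z\in\overline{\mathbb{D}}^d}\|f(z)\|_{M_m(\mathbb{C})} .$$ 3. For every $m$ and every $m\times m$ matrix $p=(p_{ij})$ of polynomials in $d$ variables, $$\|p(T)\|\le\sup_{z\in\overline{\mathbb{D}}^d}\|p(z)\|_{M_m(\mathbb{C})} .$$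 Here $f(T)$ is the operator on the $m$-fold direct sum $H\oplus\cdots\oplus H$ whose matrix entries are $f_{ij}(T)=p_{ij}(T)\,q_{ij}(T)^{-1}$ for $f_{ij}=p_{ij}/q_{ij}$ with $q_{ij}$ without zeros on $\overline{\mathbb{D}}^d$, and similarly for $p(T)$; $\|\cdot\|_{M_m(\mathbb{C})}$ is the operator norm on Euclidean $\mathbb{C}^m$. The joint spectrum $\sigma(T)$ is the set of all points $(\rho(T_1),\dots,\rho(T_d))$, where $\rho$ runs through the nonzero complex homomorphisms of the bicommutant of $\{T_1,\dots,T_d\}$ in $B(H)$. -/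

import Mathlib

open scoped ENNReal InnerProductSpace

universe u

noncomputable section

namespace PolydiscDilation

variable {H : Type u} [NormedAddCommGroup H] [InnerProductSpace ℂ H]

/-- The product `T₁ ^ n₁ * ⋯ * T_d ^ n_d`, in this order. -/
def tuplePow {d : ℕ} (T : Fin d → H →L[ℂ] H) (n : Fin d → ℕ) : H →L[ℂ] H :=
  (List.ofFn fun i => T i ^ n i).prod

/-- `p(T) = ∑ aₙ T₁ ^ n₁ ⋯ T_d ^ n_d` for a polynomial `p = ∑ aₙ z₁ ^ n₁ ⋯ z_d ^ n_d`.
(`MvPolynomial.aeval` is not available, since the algebra of operators is not commutative.) -/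
def polyEval {d : ℕ} (T : Fin d → H →L[ℂ] H) (p : MvPolynomial (Fin d) ℂ) : H →L[ℂ] H :=
  ∑ n ∈ p.support, p.coeff n • tuplePow T n

/-- The operator on the Hilbert space direct sum `H ⊕ ⋯ ⊕ H` of `m` copies of `H` given by an
`m × m` matrix of operators on `H`. -/
def matrixOp {m : ℕ} (M : Matrix (Fin m) (Fin m) (H →L[ℂ] H)) :
    PiLp 2 (fun _ : Fin m => H) →L[ℂ] PiLp 2 (fun _ : Fin m => H) :=
  ((PiLp.continuousLinearEquiv 2 ℂ (fun _ : Fin m => H)).symm :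
      (Fin m → H) →L[ℂ] PiLp 2 (fun _ : Fin m => H)) ∘L
    ContinuousLinearMap.pi fun i => ∑ j, M i j ∘L PiLp.proj 2 (fun _ : Fin m => H) j

theorem matrixOp_apply {m : ℕ} (M : Matrix (Fin m) (Fin m) (H →L[ℂ] H))
    (x : PiLp 2 (fun _ : Fin m => H)) (i : Fin m) : matrixOp M x i = ∑ j, M i j (x j) := by
  simp [matrixOp]

/-- `sup_{z ∈ X} ‖f z‖` in `[0, ∞]`, where `‖f z‖` is the operator norm of the `m × m` matrix `f z`
acting on the Euclidean space `ℂᵐ`. -/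
def supNormOn {d m : ℕ} (X : Set (Fin d → ℂ))
    (f : (Fin d → ℂ) → Matrix (Fin m) (Fin m) ℂ) : ℝ≥0∞ :=
  ⨆ z ∈ X, ‖Matrix.toEuclideanCLM (𝕜 := ℂ) (n := Fin m) (f z)‖ₑ

/-- The closed unit polydisc. -/
def closedPolydisc (d : ℕ) : Set (Fin d → ℂ) := {z | ∀ i, ‖z i‖ ≤ 1}

/-- The bicommutant of a tuple in the algebra of all bounded operators. For a commuting tuple
it is a commutative Banach algebra; it contains the inverses of those of its elements that are
invertible operators. -/
def bicommutant {d : ℕ} (T : Fin d → H →L[ℂ] H) : Subalgebra ℂ (H →L[ℂ] H) :=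
  Subalgebra.centralizer ℂ (Subalgebra.centralizer ℂ (Set.range T) : Set (H →L[ℂ] H))

theorem mem_bicommutant {d : ℕ} (T : Fin d → H →L[ℂ] H) (i : Fin d) : T i ∈ bicommutant T := by
  rw [bicommutant, Subalgebra.mem_centralizer_iff]
  intro g hg
  exact ((Subalgebra.mem_centralizer_iff ℂ).1 hg (T i) ⟨i, rfl⟩).symm

/-- The joint spectrum of a commuting tuple: the points `(ρ(T₁), …, ρ(T_d))`, where `ρ` runs
through the nonzero complex homomorphisms of the bicommutant of `T`. -/
def jointSpectrum {d : ℕ} (T : Fin d → H →L[ℂ] H) : Set (Fin d → ℂ) :=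
  {z | ∃ ρ : bicommutant T →ₐ[ℂ] ℂ, ∀ i, z i = ρ ⟨T i, mem_bicommutant T i⟩}

/-- A matrix-valued rational function, with entries `P i j / Q i j`, is evaluated at a point. -/
def ratEvalPoint {d m : ℕ} (P Q : Matrix (Fin m) (Fin m) (MvPolynomial (Fin d) ℂ))
    (z : Fin d → ℂ) : Matrix (Fin m) (Fin m) ℂ :=
  Matrix.of fun i j => (P i j).eval z / (Q i j).eval z

/-- A matrix-valued rational function, with entries `P i j / Q i j`, is evaluated at a tuple of
operators: the entries are `P i j (T) * (Q i j (T))⁻¹`. If `T` is commuting and the denominators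
have no zero on the joint spectrum, then the inverses exist, see `isUnit_polyEval`. -/
def ratEvalOp {d m : ℕ} (T : Fin d → H →L[ℂ] H)
    (P Q : Matrix (Fin m) (Fin m) (MvPolynomial (Fin d) ℂ)) :
    Matrix (Fin m) (Fin m) (H →L[ℂ] H) :=
  Matrix.of fun i j => polyEval T (P i j) * Ring.inverse (polyEval T (Q i j))

/-- `X` is a complete spectral set for `T`: it contains the joint spectrum, and
`‖f(T)‖ ≤ sup_{z ∈ X} ‖f z‖` for every square matrix `f` of rational functions that are regular
on `X`. -/
def IsCompleteSpectralSet {d : ℕ} (X : Set (Fin d → ℂ)) (T : Fin d → H →L[ℂ] H) : Prop :=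
  jointSpectrum T ⊆ X ∧
    ∀ (m : ℕ) (P Q : Matrix (Fin m) (Fin m) (MvPolynomial (Fin d) ℂ)),
      (∀ i j, ∀ z ∈ X, (Q i j).eval z ≠ 0) →
        ‖matrixOp (ratEvalOp T P Q)‖ₑ ≤ supNormOn X (ratEvalPoint P Q)

/-- `‖p(T)‖ ≤ sup_{z ∈ X} ‖p z‖` for every square matrix `p` of polynomials. -/
def MatrixVonNeumannInequality {d : ℕ} (X : Set (Fin d → ℂ)) (T : Fin d → H →L[ℂ] H) : Prop :=
  ∀ (m : ℕ) (p : Matrix (Fin m) (Fin m) (MvPolynomial (Fin d) ℂ)),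
    ‖matrixOp (p.map (polyEval T))‖ₑ ≤ supNormOn X fun z => p.map (MvPolynomial.eval z)

/-- `T` has a unitary dilation: there are commuting unitaries `U₁, …, U_d` on a Hilbert space `K`
that contains `H`, by way of a linear isometry `ι`, such that `T₁ ^ n₁ ⋯ T_d ^ n_d` is the
compression of `U₁ ^ n₁ ⋯ U_d ^ n_d` to `H` for all exponents. The adjoint of `ι` is the
orthogonal projection of `K` onto the copy of `H`, read as a map into `H`. -/
def HasUnitaryDilation [CompleteSpace H] {d : ℕ} (T : Fin d → H →L[ℂ] H) : Prop :=
  ∃ (K : Type u) (_ : NormedAddCommGroup K) (_ : InnerProductSpace ℂ K) (_ : CompleteSpace K)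
    (ι : H →ₗᵢ[ℂ] K) (U : Fin d → K →L[ℂ] K),
    (∀ i, U i ∈ unitary (K →L[ℂ] K)) ∧ (∀ i j, Commute (U i) (U j)) ∧
      ∀ n : Fin d → ℕ, tuplePow T n =
        ContinuousLinearMap.adjoint ι.toContinuousLinearMap ∘L tuplePow U n ∘L
          ι.toContinuousLinearMap

theorem tuplePow_mem_bicommutant {d : ℕ} (T : Fin d → H →L[ℂ] H) (n : Fin d → ℕ) :
    tuplePow T n ∈ bicommutant T := by
  refine Subalgebra.list_prod_mem _ fun x hx => ?_
  obtain ⟨i, rfl⟩ := (List.mem_ofFn' _ _).1 hx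
  exact pow_mem (mem_bicommutant T i) _

theorem polyEval_mem_bicommutant {d : ℕ} (T : Fin d → H →L[ℂ] H) (p : MvPolynomial (Fin d) ℂ) :
    polyEval T p ∈ bicommutant T :=
  Subalgebra.sum_mem _ fun n _ => Subalgebra.smul_mem _ (tuplePow_mem_bicommutant T n) _

theorem map_polyEval {d : ℕ} (T : Fin d → H →L[ℂ] H) (p : MvPolynomial (Fin d) ℂ)
    (ρ : bicommutant T →ₐ[ℂ] ℂ) :
    ρ ⟨polyEval T p, polyEval_mem_bicommutant T p⟩ =
      p.eval fun i => ρ ⟨T i, mem_bicommutant T i⟩ := by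
  have h1 : (⟨polyEval T p, polyEval_mem_bicommutant T p⟩ : bicommutant T) =
      ∑ n ∈ p.support, p.coeff n •
        (List.ofFn fun i => (⟨T i, mem_bicommutant T i⟩ : bicommutant T) ^ n i).prod := by
    apply Subtype.ext
    rw [← Subalgebra.coe_val, map_sum]
    simp only [map_smul, map_list_prod, List.map_ofFn]
    rfl
  rw [h1, map_sum, MvPolynomial.eval_eq']
  refine Finset.sum_congr rfl fun n _ => ?_
  rw [AlgHom.map_smul_of_tower, map_list_prod, List.map_ofFn, List.prod_ofFn, smul_eq_mul]
  simp only [Function.comp_apply, map_pow]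

theorem isUnit_polyEval [CompleteSpace H] {d : ℕ} (T : Fin d → H →L[ℂ] H)
    (hT : ∀ i j, Commute (T i) (T j)) (q : MvPolynomial (Fin d) ℂ)
    (hq : ∀ z ∈ jointSpectrum T, q.eval z ≠ 0) : IsUnit (polyEval T q) := by
  have hle : bicommutant T ≤ Subalgebra.centralizer ℂ (Set.range T) := by
    refine Subalgebra.centralizer_le ℂ _ _ ?_
    rintro _ ⟨i, rfl⟩
    refine (Subalgebra.mem_centralizer_iff ℂ).2 ?_
    rintro _ ⟨j, rfl⟩
    exact hT j i
  let _ : NormedCommRing (bicommutant T) :=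
    { (inferInstance : NormedRing (bicommutant T)) with
      mul_comm := fun a b => Subtype.ext
        (((Subalgebra.mem_centralizer_iff ℂ).1 a.2 _ (hle b.2)).symm) }
  have : CompleteSpace (bicommutant T) := by
    have hc : IsClosed (bicommutant T : Set (H →L[ℂ] H)) := Set.isClosed_centralizer _
    exact hc.completeSpace_coe
  have h : IsUnit (⟨polyEval T q, polyEval_mem_bicommutant T q⟩ : bicommutant T) := by
    by_contra hn
    obtain ⟨f, hf⟩ := WeakDual.CharacterSpace.exists_apply_eq_zero hn
    refine hq (fun i => f ⟨T i, mem_bicommutant T i⟩)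
      ⟨WeakDual.CharacterSpace.toAlgHom f, fun i => rfl⟩ ?_
    rw [← hf]
    exact (map_polyEval T q (WeakDual.CharacterSpace.toAlgHom f)).symm
  exact h.map (bicommutant T).val

end PolydiscDilation

end

/-! A compression to H does not increase norms, so (1) ⇒ (3) reduces to commuting unitaries. These
generate a commutative C⋆-algebra, whose Gelfand transform turns a matrix of polynomials into a
matrix-valued function taking its values at points of the polydisc; star homomorphisms being
contractive, the inequality follows (`enorm_matrixOp_aeval_le`).

(2) ⇒ (3) is the case of denominators 1. Conversely, characters are contractive, so the joint
spectrum lies in the polydisc, and 1/q is there a uniform limit of polynomials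
(`exists_polynomial_approx_inv`). By (3) the approximation passes to T.

For (3) ⇒ (1), the extension of the polynomial calculus to a completely positive map and the
Stinespring construction are merged into one scalar argument. For z in the torus and a family a of
scalars indexed by H, send the form ∑ conj(a_x) p_xy(z) a_y to ∑ ⟨x, p_xy(T) y⟩. The matrix
inequality makes this functional positive (`re_sum_inner_nonneg`). M. Riesz extends it to a positive
Λ on all functions of (z, a) dominated by diagonal forms ∑ c_x |a_x|². In the Hilbert space obtained
from the semi-inner product Λ(conj(F) G), multiplication by the coordinates z_i gives commuting
unitaries, and x ↦ (the function a_x) embeds H. -/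

noncomputable section

namespace PolydiscDilation

/-! ### Polynomial calculus and operator matrices. -/

section Basic

variable {H : Type u} [NormedAddCommGroup H] [InnerProductSpace ℂ H]

open scoped IsMulCommutative in
/-- For a commuting tuple the polynomial calculus is multiplicative. -/
theorem exists_algHom_eq_polyEval {d : ℕ} {T : Fin d → H →L[ℂ] H}
    (hT : ∀ i j, Commute (T i) (T j)) :
    ∃ φ : MvPolynomial (Fin d) ℂ →ₐ[ℂ] (H →L[ℂ] H),
      (∀ i, φ (MvPolynomial.X i) = T i) ∧ ∀ p, φ p = polyEval T p := by
  have : IsMulCommutative (Algebra.adjoin ℂ (Set.range T)) :=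
    Algebra.isMulCommutative_adjoin ℂ (by
      rintro _ ⟨i, rfl⟩ _ ⟨j, rfl⟩
      exact hT i j)
  let t : Fin d → Algebra.adjoin ℂ (Set.range T) :=
    fun i => ⟨T i, Algebra.subset_adjoin ⟨i, rfl⟩⟩
  let φ : MvPolynomial (Fin d) ℂ →ₐ[ℂ] Algebra.adjoin ℂ (Set.range T) := MvPolynomial.aeval t
  refine ⟨(Algebra.adjoin ℂ (Set.range T)).val.comp φ, fun i => by simp [φ, t], fun p => ?_⟩
  have h : φ p = ∑ n ∈ p.support, p.coeff n • (List.ofFn fun i => t i ^ n i).prod := by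
    simp only [φ, MvPolynomial.aeval_def, MvPolynomial.eval₂_eq', Algebra.smul_def, List.prod_ofFn]
  rw [AlgHom.comp_apply, h, map_sum]
  refine Finset.sum_congr rfl fun n _ => ?_
  rw [map_smul, map_list_prod, List.map_ofFn]
  rfl

theorem polyEval_one {d : ℕ} (T : Fin d → H →L[ℂ] H) : polyEval T 1 = 1 := by
  have : (MvPolynomial.support (1 : MvPolynomial (Fin d) ℂ)) = {0} := MvPolynomial.support_one
  rw [polyEval, this]
  simp [tuplePow, List.ofFn_const]

theorem matrixOp_mul {m : ℕ} (M N : Matrix (Fin m) (Fin m) (H →L[ℂ] H)) :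
    matrixOp (M * N) = matrixOp M * matrixOp N := by
  ext x i
  simp only [matrixOp_apply, mul_apply_eq_comp, Matrix.mul_apply,
    _root_.sum_apply, map_sum]
  exact Finset.sum_comm

theorem matrixOp_add {m : ℕ} (M N : Matrix (Fin m) (Fin m) (H →L[ℂ] H)) :
    matrixOp (M + N) = matrixOp M + matrixOp N := by
  ext x i
  simp [matrixOp_apply, Finset.sum_add_distrib]

theorem matrixOp_smul {m : ℕ} (c : ℂ) (M : Matrix (Fin m) (Fin m) (H →L[ℂ] H)) :
    matrixOp (c • M) = c • matrixOp M := by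
  ext x i
  simp [matrixOp_apply, Finset.smul_sum]

theorem matrixOp_zero {m : ℕ} : matrixOp (0 : Matrix (Fin m) (Fin m) (H →L[ℂ] H)) = 0 := by
  ext x i
  simp [matrixOp_apply]

theorem matrixOp_one {m : ℕ} : matrixOp (1 : Matrix (Fin m) (Fin m) (H →L[ℂ] H)) = 1 := by
  ext x i
  simp only [matrixOp_apply, Matrix.one_apply, one_apply_eq_self]
  rw [Finset.sum_eq_single i] <;> simp +contextual [eq_comm]

theorem inner_matrixOp {m : ℕ} (M : Matrix (Fin m) (Fin m) (H →L[ℂ] H))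
    (x y : PiLp 2 (fun _ : Fin m => H)) :
    ⟪x, matrixOp M y⟫_ℂ = ∑ i, ∑ j, ⟪x i, M i j (y j)⟫_ℂ := by
  simp [PiLp.inner_apply, matrixOp_apply, inner_sum]

theorem matrixOp_star [CompleteSpace H] {m : ℕ} (M : Matrix (Fin m) (Fin m) (H →L[ℂ] H)) :
    matrixOp (star M) = star (matrixOp M) := by
  rw [ContinuousLinearMap.star_eq_adjoint, ContinuousLinearMap.eq_adjoint_iff]
  intro x y
  rw [← inner_conj_symm, inner_matrixOp, inner_matrixOp, Finset.sum_comm, map_sum]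
  refine Finset.sum_congr rfl fun j _ => ?_
  rw [map_sum]
  refine Finset.sum_congr rfl fun i _ => ?_
  rw [inner_conj_symm, Matrix.star_apply, ContinuousLinearMap.star_eq_adjoint,
    ContinuousLinearMap.adjoint_inner_left]

/-- A matrix of operators, as a linear function of its entries, is continuous. -/
theorem continuous_matrixOp {m : ℕ} :
    Continuous (matrixOp : Matrix (Fin m) (Fin m) (H →L[ℂ] H) → _) := by
  have h : ∀ M : Matrix (Fin m) (Fin m) (H →L[ℂ] H),
      matrixOp M = ((PiLp.continuousLinearEquiv 2 ℂ (fun _ : Fin m => H)).symm :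
        (Fin m → H) →L[ℂ] PiLp 2 (fun _ : Fin m => H)) ∘L
          ∑ i, ∑ j, (ContinuousLinearMap.single ℂ (fun _ : Fin m => H) i) ∘L (M i j) ∘L
            PiLp.proj 2 (fun _ : Fin m => H) j := by
    intro M
    ext x i
    simp only [matrixOp_apply, ContinuousLinearMap.comp_apply, _root_.sum_apply,
      ContinuousLinearEquiv.coe_coe, ContinuousLinearMap.single_apply, PiLp.proj_apply]
    simp only [PiLp.continuousLinearEquiv_symm_apply, Finset.sum_apply, Pi.single_apply]
    rw [Finset.sum_comm]
    simp
  simp_rw [funext h]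
  fun_prop

theorem matrixVonNeumannInequality_of_isCompleteSpectralSet {d : ℕ} {X : Set (Fin d → ℂ)}
    {T : Fin d → H →L[ℂ] H} (h : IsCompleteSpectralSet X T) : MatrixVonNeumannInequality X T := by
  intro m p
  have := h.2 m p (Matrix.of fun _ _ => 1) (by simp)
  have h1 : ratEvalOp T p (Matrix.of fun _ _ => 1) = p.map (polyEval T) := by
    ext1 i j
    simp [ratEvalOp, polyEval_one]
  have h2 : ratEvalPoint p (Matrix.of fun _ _ => 1) =
      fun z => p.map (MvPolynomial.eval z) := by
    funext z
    ext1 i j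
    simp [ratEvalPoint]
  rwa [h1, h2] at this

end Basic

/-! ### The polydisc algebra. -/

section Approximation

theorem isCompact_closedPolydisc (d : ℕ) : IsCompact (closedPolydisc d) := by
  have : closedPolydisc d = Set.univ.pi fun _ => Metric.closedBall (0 : ℂ) 1 := by
    ext z
    simp [closedPolydisc]
  rw [this]
  exact isCompact_univ_pi fun _ => isCompact_closedBall _ _

theorem exists_bound_eval {d m : ℕ} (P : Matrix (Fin m) (Fin m) (MvPolynomial (Fin d) ℂ)) :
    ∃ B, ∀ i j, ∀ z ∈ closedPolydisc d, ‖(P i j).eval z‖ ≤ B := by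
  have hbdd : ∀ i j, ∃ C, ∀ z ∈ closedPolydisc d, ‖(P i j).eval z‖ ≤ C := fun i j =>
    (isCompact_closedPolydisc d).exists_bound_of_continuousOn
      (MvPolynomial.continuous_eval (P i j)).continuousOn
  choose C hC using hbdd
  refine ⟨∑ i, ∑ j, C i j, fun i j z hz => (hC i j z hz).trans ?_⟩
  have hpos : ∀ i j, 0 ≤ C i j := fun i j => (norm_nonneg _).trans (hC i j z hz)
  exact (Finset.single_le_sum (f := fun j => C i j) (fun j _ => hpos i j)
    (Finset.mem_univ j)).trans (Finset.single_le_sum (f := fun i => ∑ j, C i j)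
      (fun i _ => Finset.sum_nonneg fun j _ => hpos i j) (Finset.mem_univ i))

/-- A character of a closed subalgebra is contractive. -/
theorem norm_algHom_apply_le {B : Type*} [NormedRing B] [NormedAlgebra ℂ B] (A : Subalgebra ℂ B)
    [CompleteSpace A] (f : A →ₐ[ℂ] ℂ) (a : A) (h : ‖(1 : B)‖ ≤ 1) : ‖f a‖ ≤ ‖(a : B)‖ :=
  (AlgHom.norm_apply_le_self_mul_norm_one f a).trans (mul_le_of_le_one_right (norm_nonneg _) h)

/-- The reciprocal of a polynomial without zeros on the closed polydisc is a uniform limit of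
polynomials there: it belongs to the polydisc algebra, whose characters are point evaluations. -/
theorem exists_polynomial_approx_inv {d : ℕ} {q : MvPolynomial (Fin d) ℂ}
    (hq : ∀ z ∈ closedPolydisc d, q.eval z ≠ 0) {ε : ℝ} (hε : 0 < ε) :
    ∃ r : MvPolynomial (Fin d) ℂ, ∀ z ∈ closedPolydisc d, ‖r.eval z - (q.eval z)⁻¹‖ < ε := by
  have : CompactSpace (closedPolydisc d) := isCompact_iff_compactSpace.1 (isCompact_closedPolydisc d)
  let x : Fin d → C(closedPolydisc d, ℂ) := fun i => ⟨fun z => z.1 i, (continuous_apply i).comp continuous_subtype_val⟩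
  let φ : MvPolynomial (Fin d) ℂ →ₐ[ℂ] C(closedPolydisc d, ℂ) := MvPolynomial.aeval x
  have hφ : ∀ p z, φ p z = p.eval z.1 := by
    intro p z
    have h : ((ContinuousMap.evalAlgHom ℂ ℂ z).comp φ) = MvPolynomial.aeval z.1 := by
      ext i
      simp only [φ, AlgHom.comp_apply, MvPolynomial.aeval_X]
      rfl
    exact (DFunLike.congr_fun h p).trans (by simp [MvPolynomial.aeval_eq_eval])
  let A : Subalgebra ℂ C(closedPolydisc d, ℂ) := φ.range.topologicalClosure
  have : CompleteSpace A := (Subalgebra.isClosed_topologicalClosure _).completeSpace_coe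
  let ψ : MvPolynomial (Fin d) ℂ →ₐ[ℂ] A :=
    φ.codRestrict A fun p => Subalgebra.le_topologicalClosure _ ⟨p, rfl⟩
  have hu : IsUnit (ψ q) := by
    by_contra hn
    obtain ⟨f, hf⟩ := WeakDual.CharacterSpace.exists_apply_eq_zero hn
    have h : ((WeakDual.CharacterSpace.toAlgHom f).comp ψ) =
        MvPolynomial.aeval fun i => f (ψ (MvPolynomial.X i)) := by
      ext i
      simp
    -- The character is evaluation at this point; it lies in the polydisc because the coordinate
    -- functions have sup norm at most 1.
    refine hq (fun i => f (ψ (MvPolynomial.X i))) (fun i => ?_) ?_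
    · refine (norm_algHom_apply_le A (WeakDual.CharacterSpace.toAlgHom f) _
        ((ContinuousMap.norm_le _ zero_le_one).2 fun z => by simp)).trans ?_
      change ‖φ (MvPolynomial.X i)‖ ≤ 1
      refine (ContinuousMap.norm_le _ zero_le_one).2 fun z => ?_
      rw [hφ, MvPolynomial.eval_X]
      exact z.2 i
    · rw [← hf]
      have := DFunLike.congr_fun h q
      simpa [MvPolynomial.aeval_eq_eval] using this.symm
  obtain ⟨g, hg⟩ := hu.exists_right_inv
  -- The inverse was found inside `A`, the closure of the polynomials; this is what makes it
  -- approximable.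
  obtain ⟨_, ⟨r, rfl⟩, hr⟩ := Metric.mem_closure_iff.1 g.2 ε hε
  refine ⟨r, fun z hz => ?_⟩
  have h1 : q.eval z * g.1 ⟨z, hz⟩ = 1 := by
    have := congrArg (fun a : A => a.1 ⟨z, hz⟩) hg
    simpa [ψ, hφ] using this
  rw [inv_eq_of_mul_eq_one_right h1, ← hφ r ⟨z, hz⟩, ← dist_eq_norm, dist_comm]
  exact (ContinuousMap.dist_apply_le_dist _).trans_lt hr

end Approximation

/-! ### From polynomials to rational functions. -/

section Spectrum

variable {H : Type u} [NormedAddCommGroup H] [InnerProductSpace ℂ H]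

theorem jointSpectrum_subset_closedPolydisc [CompleteSpace H] {d : ℕ} {T : Fin d → H →L[ℂ] H}
    (hT : ∀ i, ‖T i‖ ≤ 1) : jointSpectrum T ⊆ closedPolydisc d := by
  rintro z ⟨ρ, hρ⟩ i
  have : CompleteSpace (bicommutant T) := by
    have hc : IsClosed (bicommutant T : Set (H →L[ℂ] H)) := Set.isClosed_centralizer _
    exact hc.completeSpace_coe
  rw [hρ]
  exact (norm_algHom_apply_le _ ρ _ ContinuousLinearMap.norm_id_le).trans (hT i)

/-- Expansion in matrix units. The constant is crude but depends only on m, which suffices for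
boundedness and for limits η → 0. -/
theorem norm_toEuclideanCLM_le {m : ℕ} (M : Matrix (Fin m) (Fin m) ℂ) {η : ℝ}
    (hM : ∀ i j, ‖M i j‖ ≤ η) :
    ‖Matrix.toEuclideanCLM (𝕜 := ℂ) (n := Fin m) M‖ ≤
      η * ∑ i, ∑ j, ‖Matrix.toEuclideanCLM (𝕜 := ℂ) (n := Fin m) (Matrix.single i j 1)‖ := by
  have h : M = ∑ i, ∑ j, M i j • Matrix.single i j (1 : ℂ) := by
    simpa [Matrix.smul_single] using Matrix.matrix_eq_sum_single M
  conv_lhs => rw [h]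
  simp only [map_sum, map_smul, Finset.mul_sum]
  refine (norm_sum_le _ _).trans (Finset.sum_le_sum fun i _ => ?_)
  refine (norm_sum_le _ _).trans (Finset.sum_le_sum fun j _ => ?_)
  rw [norm_smul]
  gcongr
  exact hM i j

/-- The case m = 1, with 1 × 1 matrices read as scalars and as operators on H. -/
theorem norm_polyEval_le {d : ℕ} {X : Set (Fin d → ℂ)} {T : Fin d → H →L[ℂ] H}
    (h : MatrixVonNeumannInequality X T) (p : MvPolynomial (Fin d) ℂ) {η : ℝ} (hη : 0 ≤ η)
    (hp : ∀ z ∈ X, ‖p.eval z‖ ≤ η) : ‖polyEval T p‖ ≤ η := by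
  have h1 := h 1 (Matrix.of fun _ _ => p)
  have h2 : supNormOn X (fun z => (Matrix.of fun _ _ : Fin 1 => p).map (MvPolynomial.eval z)) ≤
      ENNReal.ofReal η := by
    refine iSup₂_le fun z hz => ?_
    rw [← ofReal_norm]
    refine ENNReal.ofReal_le_ofReal (ContinuousLinearMap.opNorm_le_bound _ hη fun v => ?_)
    have : Matrix.toEuclideanCLM (𝕜 := ℂ) (n := Fin 1)
        ((Matrix.of fun _ _ : Fin 1 => p).map (MvPolynomial.eval z)) v = p.eval z • v := by
      ext i
      simp [Matrix.ofLp_toEuclideanCLM, Matrix.mulVec, dotProduct, Subsingleton.elim i 0]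
    rw [this, norm_smul]
    gcongr
    exact hp z hz
  have h3 : ‖matrixOp ((Matrix.of fun _ _ : Fin 1 => p).map (polyEval T))‖ ≤ η := by
    have := h1.trans h2
    rw [← ofReal_norm] at this
    exact (ENNReal.ofReal_le_ofReal_iff hη).1 this
  refine ContinuousLinearMap.opNorm_le_bound _ hη fun x => ?_
  have h4 := ContinuousLinearMap.le_of_opNorm_le _ h3 (WithLp.toLp 2 fun _ : Fin 1 => x)
  simpa [EuclideanSpace.norm_eq, PiLp.norm_eq_of_L2, matrixOp_apply] using h4

open Filter Topology in
theorem isCompleteSpectralSet_of_matrixVonNeumannInequality [CompleteSpace H] {d : ℕ} {T : Fin d → H →L[ℂ] H}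
    (hcomm : ∀ i j, Commute (T i) (T j)) (hcontr : ∀ i, ‖T i‖ ≤ 1)
    (h : MatrixVonNeumannInequality (closedPolydisc d) T) :
    IsCompleteSpectralSet (closedPolydisc d) T := by
  refine ⟨jointSpectrum_subset_closedPolydisc hcontr, fun m P Q hQ => ?_⟩
  obtain ⟨φ, -, hφ⟩ := exists_algHom_eq_polyEval hcomm
  obtain ⟨C, hC⟩ := exists_bound_eval Q
  choose r hr using fun i j (n : ℕ) =>
    exists_polynomial_approx_inv (hQ i j) (ε := 1 / ((n : ℝ) + 1)) (by positivity)
  let F : ℕ → Matrix (Fin m) (Fin m) (MvPolynomial (Fin d) ℂ) :=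
    fun n => Matrix.of fun i j => P i j * r i j n
  have h0 : ∀ c : ℝ, Tendsto (fun n : ℕ => 1 / ((n : ℝ) + 1) * c) atTop (𝓝 0) := fun c => by
    simpa using tendsto_one_div_add_atTop_nhds_zero_nat.mul_const c
  have hunit : ∀ i j, IsUnit (polyEval T (Q i j)) := fun i j =>
    isUnit_polyEval T hcomm _ fun z hz =>
      hQ i j z (jointSpectrum_subset_closedPolydisc hcontr hz)
  have hinv : ∀ i j, Tendsto (fun n => polyEval T (r i j n)) atTop
      (𝓝 (Ring.inverse (polyEval T (Q i j)))) := by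
    intro i j
    rw [tendsto_iff_norm_sub_tendsto_zero]
    refine squeeze_zero (fun _ => norm_nonneg _) (fun n => ?_)
      (h0 (C * ‖Ring.inverse (polyEval T (Q i j))‖))
    -- The error becomes the polynomial rQ - 1 evaluated at T, to which the von Neumann inequality
    -- applies; on the polydisc it is at most C/(n + 1).
    have h1 : polyEval T (r i j n) - Ring.inverse (polyEval T (Q i j)) =
        polyEval T (r i j n * Q i j - 1) * Ring.inverse (polyEval T (Q i j)) := by
      rw [← hφ (_ - _), map_sub, map_mul, map_one, hφ, hφ, sub_mul, one_mul,
        Ring.mul_inverse_cancel_right _ _ (hunit i j)]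
    rw [h1, ← mul_assoc]
    refine (norm_mul_le _ _).trans ?_
    gcongr
    have hpos : 0 ≤ C := (norm_nonneg _).trans (hC i j 0 (by simp [closedPolydisc]))
    refine norm_polyEval_le h _ (by positivity) fun z hz => ?_
    have h2 : (r i j n * Q i j - 1).eval z =
        ((r i j n).eval z - ((Q i j).eval z)⁻¹) * (Q i j).eval z := by
      have := hQ i j z hz
      simp only [map_sub, map_mul, map_one]
      field_simp
    rw [h2, norm_mul]
    exact mul_le_mul (hr i j n z hz).le (hC i j z hz) (norm_nonneg _) (by positivity)
  have hlim : Tendsto (fun n => ‖matrixOp ((F n).map (polyEval T))‖ₑ) atTop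
      (𝓝 ‖matrixOp (ratEvalOp T P Q)‖ₑ) := by
    refine (continuous_enorm.tendsto _).comp ((continuous_matrixOp.tendsto _).comp ?_)
    refine tendsto_pi_nhds.2 fun i => tendsto_pi_nhds.2 fun j => ?_
    have : ∀ n, polyEval T (P i j * r i j n) = polyEval T (P i j) * polyEval T (r i j n) :=
      fun n => by rw [← hφ, map_mul, hφ, hφ]
    simpa [F, ratEvalOp, this] using (hinv i j).const_mul (polyEval T (P i j))
  obtain ⟨B, hB⟩ := exists_bound_eval P
  let κ := ∑ i, ∑ j, ‖Matrix.toEuclideanCLM (𝕜 := ℂ) (n := Fin m) (Matrix.single i j 1)‖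
  have hsup : ∀ n, ‖matrixOp ((F n).map (polyEval T))‖ₑ ≤
      supNormOn (closedPolydisc d) (ratEvalPoint P Q) +
        ENNReal.ofReal (1 / ((n : ℝ) + 1) * (B * κ)) := by
    intro n
    refine (h m (F n)).trans (iSup₂_le fun z hz => ?_)
    have h1 : (F n).map (MvPolynomial.eval z) =
        ratEvalPoint P Q z + ((F n).map (MvPolynomial.eval z) - ratEvalPoint P Q z) := by abel
    beta_reduce
    rw [h1, map_add]
    refine (enorm_add_le (Matrix.toEuclideanCLM (𝕜 := ℂ) (n := Fin m) _) _).trans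
      (add_le_add ?_ ?_)
    · exact le_iSup₂ (f := fun z (_ : z ∈ closedPolydisc d) =>
        ‖Matrix.toEuclideanCLM (𝕜 := ℂ) (n := Fin m) (ratEvalPoint P Q z)‖ₑ) z hz
    · rw [← ofReal_norm, ← mul_assoc]
      refine ENNReal.ofReal_le_ofReal (norm_toEuclideanCLM_le _ fun i j => ?_)
      have h2 : ((F n).map (MvPolynomial.eval z) - ratEvalPoint P Q z) i j =
          ((r i j n).eval z - ((Q i j).eval z)⁻¹) * (P i j).eval z := by
        simp only [F, ratEvalPoint, Matrix.sub_apply, Matrix.map_apply, Matrix.of_apply, map_mul]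
        ring
      rw [h2, norm_mul]
      exact mul_le_mul (hr i j n z hz).le (hB i j z hz) (norm_nonneg _) (by positivity)
  refine le_of_tendsto_of_tendsto' hlim ?_ hsup
  have h3 := (ENNReal.continuous_ofReal.tendsto 0).comp (h0 (B * κ))
  rw [ENNReal.ofReal_zero] at h3
  simpa using (tendsto_const_nhds (x := supNormOn (closedPolydisc d) (ratEvalPoint P Q))).add h3

end Spectrum

/-! ### Commuting unitaries and Gelfand theory. -/

section UnitaryTuple

variable {K : Type u} [NormedAddCommGroup K] [InnerProductSpace ℂ K]

open scoped Matrix.Norms.L2Operator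

/-- The `(i, j)` entry of a continuous matrix-valued function. -/
def entryMap {X : Type*} [TopologicalSpace X] {m : ℕ}
    (F : C(X, Matrix (Fin m) (Fin m) ℂ)) (i j : Fin m) : C(X, ℂ) :=
  ⟨fun x => F x i j, by
    exact (continuous_apply j).comp ((continuous_apply i).comp F.continuous)⟩

/-- A representation of a commutative C⋆-algebra of functions, applied entrywise to matrices. -/
def matrixRep [CompleteSpace K] {X : Type*} [TopologicalSpace X]
    (π : C(X, ℂ) →⋆ₐ[ℂ] (K →L[ℂ] K)) (m : ℕ) :
    C(X, Matrix (Fin m) (Fin m) ℂ) →⋆ₙₐ[ℂ]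
      (PiLp 2 (fun _ : Fin m => K) →L[ℂ] PiLp 2 (fun _ : Fin m => K)) where
  toFun F := matrixOp (Matrix.of fun i j => π (entryMap F i j))
  map_smul' c F := by
    rw [MonoidHom.id_apply, ← matrixOp_smul]
    congr 1
    ext1 i j
    have : entryMap (c • F) i j = c • entryMap F i j := rfl
    simp [this]
  map_zero' := by
    rw [← matrixOp_zero]
    congr 1
    ext1 i j
    have : entryMap (0 : C(X, Matrix (Fin m) (Fin m) ℂ)) i j = 0 := rfl
    simp [this]
  map_add' F G := by
    rw [← matrixOp_add]
    congr 1
    ext1 i j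
    have : entryMap (F + G) i j = entryMap F i j + entryMap G i j := rfl
    simp [this]
  map_mul' F G := by
    rw [← matrixOp_mul]
    congr 1
    ext1 i j
    have : entryMap (F * G) i j = ∑ k, entryMap F i k * entryMap G k j := by
      ext x
      simp [entryMap, Matrix.mul_apply]
    simp [this, Matrix.mul_apply]
  map_star' F := by
    rw [← matrixOp_star]
    congr 1
    ext1 i j
    have : entryMap (star F) i j = star (entryMap F j i) := rfl
    simp [this, Matrix.star_apply, map_star]

/-- Von Neumann's inequality for matrices of polynomials in commuting normal contractions. -/
theorem enorm_matrixOp_aeval_le [CompleteSpace K] {A : Type*} [CommCStarAlgebra A]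
    (π : A →⋆ₐ[ℂ] (K →L[ℂ] K)) {d m : ℕ} {a : Fin d → A} (ha : ∀ i, ‖a i‖ ≤ 1)
    (p : Matrix (Fin m) (Fin m) (MvPolynomial (Fin d) ℂ)) :
    ‖matrixOp (p.map fun q => π (MvPolynomial.aeval a q))‖ₑ ≤
      supNormOn (closedPolydisc d) fun z => p.map (MvPolynomial.eval z) := by
  let G := gelfandStarTransform A
  let Ψ := matrixRep (π.comp (G.symm : C(WeakDual.characterSpace ℂ A, ℂ) →⋆ₐ[ℂ] A)) m
  let F : C(WeakDual.characterSpace ℂ A, Matrix (Fin m) (Fin m) ℂ) :=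
    ⟨fun χ => Matrix.of fun i j => G (MvPolynomial.aeval a (p i j)) χ,
      continuous_pi fun i => continuous_pi fun j => (G (MvPolynomial.aeval a (p i j))).continuous⟩
  have hF : Ψ F = matrixOp (p.map fun q => π (MvPolynomial.aeval a q)) := by
    change matrixOp _ = matrixOp _
    congr 1
    ext1 i j
    have : entryMap F i j = G (MvPolynomial.aeval a (p i j)) := rfl
    simp [this]
  rw [← hF]
  -- Star homomorphisms of C⋆-algebras are contractive, so only the sup norm of `F` over the
  -- characters remains.
  refine (enorm_le_iff_norm_le.2 (NonUnitalStarAlgHom.norm_apply_le Ψ F)).trans ?_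
  by_cases hS : supNormOn (closedPolydisc d) (fun z => p.map (MvPolynomial.eval z)) = ⊤
  · rw [hS]
    exact le_top
  lift supNormOn (closedPolydisc d) (fun z => p.map (MvPolynomial.eval z)) to NNReal using hS
    with s hs
  have h2 : ‖F‖₊ ≤ s := by
    refine (ContinuousMap.norm_le _ s.2).2 fun χ => ?_
    have h3 : F χ = p.map (MvPolynomial.eval fun i => χ (a i)) := by
      ext1 i j
      have h4 : ((WeakDual.CharacterSpace.toAlgHom χ).comp (MvPolynomial.aeval a)) =
          MvPolynomial.aeval fun i => χ (a i) := by
        ext i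
        simp
      have := DFunLike.congr_fun h4 (p i j)
      have h5 : χ (MvPolynomial.aeval a (p i j)) = (p i j).eval fun i => χ (a i) := by
        simpa [MvPolynomial.aeval_eq_eval] using this
      exact h5
    have h5 : (fun i => χ (a i)) ∈ closedPolydisc d := fun i =>
      (((G (a i)).norm_coe_le_norm χ).trans (gelfandTransform_isometry A |>.norm_map_of_map_zero
        (map_zero _) (a i)).le).trans (ha i)
    rw [h3]
    have h6 := le_iSup₂ (f := fun z (_ : z ∈ closedPolydisc d) =>
        ‖Matrix.toEuclideanCLM (𝕜 := ℂ) (n := Fin m) (p.map (MvPolynomial.eval z))‖ₑ) _ h5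
    change _ ≤ supNormOn _ _ at h6
    rw [← hs] at h6
    exact ENNReal.coe_le_coe.1 h6
  exact ENNReal.coe_le_coe.2 h2

theorem matrixVonNeumannInequality_of_unitary [CompleteSpace K] {d : ℕ} {U : Fin d → K →L[ℂ] K}
    (hU : ∀ i, U i ∈ unitary (K →L[ℂ] K)) (hcomm : ∀ i j, Commute (U i) (U j)) :
    MatrixVonNeumannInequality (closedPolydisc d) U := by
  -- The adjoint of a unitary is its inverse, so Fuglede's theorem is not needed.
  have hstar : ∀ i j, Commute (U i) (star (U j)) := fun i j => by
    have h1 := (hcomm i j).units_inv_right (u := Unitary.toUnits ⟨U j, hU j⟩)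
    exact h1
  let B := StarAlgebra.adjoin ℂ (Set.range U)
  have hB : IsMulCommutative B := by
    refine StarAlgebra.isMulCommutative_adjoin _ ?_ ?_
    · rintro _ ⟨i, rfl⟩ _ ⟨j, rfl⟩
      exact hcomm i j
    · rintro _ ⟨i, rfl⟩ _ ⟨j, rfl⟩
      exact hstar i j
  let A := B.topologicalClosure
  have hA : ∀ x y : A, x * y = y * x :=
    (B.commRingTopologicalClosure hB.is_comm.comm).mul_comm
  have : IsClosed (A : Set (K →L[ℂ] K)) := B.isClosed_topologicalClosure
  let _ : CStarAlgebra A := StarSubalgebra.cstarAlgebra A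
  let _ : CommCStarAlgebra A := { mul_comm := hA }
  let a : Fin d → A := fun i =>
    ⟨U i, B.le_topologicalClosure (StarAlgebra.subset_adjoin ℂ _ ⟨i, rfl⟩)⟩
  have ha : ∀ i, ‖a i‖ ≤ 1 := fun i => by
    have h1 := CStarRing.norm_star_mul_self (x := U i)
    rw [(Unitary.mem_iff.1 (hU i)).1] at h1
    have h2 : ‖(1 : K →L[ℂ] K)‖ ≤ 1 := ContinuousLinearMap.norm_id_le
    change ‖U i‖ ≤ 1
    nlinarith [norm_nonneg (U i)]
  obtain ⟨φ, hφX, hφ⟩ := exists_algHom_eq_polyEval hcomm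
  have h : (A.subtype : A →ₐ[ℂ] (K →L[ℂ] K)).comp (MvPolynomial.aeval a) = φ := by
    ext i
    simp [hφX, a]
  intro m p
  have h1 := enorm_matrixOp_aeval_le A.subtype ha p
  have h2 : (fun q => A.subtype (MvPolynomial.aeval a q)) = polyEval U := by
    funext q
    rw [← hφ, ← h]
    rfl
  rwa [h2] at h1

end UnitaryTuple

/-! ### Passage from the dilation to the compression. -/

section Compression

variable {H : Type u} [NormedAddCommGroup H] [InnerProductSpace ℂ H] [CompleteSpace H]

theorem matrixVonNeumannInequality_of_hasUnitaryDilation {d : ℕ} {T : Fin d → H →L[ℂ] H}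
    (h : HasUnitaryDilation T) : MatrixVonNeumannInequality (closedPolydisc d) T := by
  obtain ⟨K, _, _, _, ι, U, hU, hcomm, hdil⟩ := h
  intro m p
  refine le_trans ?_ (matrixVonNeumannInequality_of_unitary hU hcomm m p)
  have hp : ∀ q x y, ⟪x, polyEval T q y⟫_ℂ = ⟪ι x, polyEval U q (ι y)⟫_ℂ := by
    intro q x y
    simp only [polyEval, _root_.sum_apply, inner_sum, hdil, _root_.smul_apply,
      inner_smul_right, ContinuousLinearMap.comp_apply, ContinuousLinearMap.adjoint_inner_right]
    rfl
  -- The m-fold direct sum of ι is isometric and carries the sesquilinear form of p(T) to that of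
  -- p(U).
  let J : PiLp 2 (fun _ : Fin m => H) → PiLp 2 (fun _ : Fin m => K) :=
    fun x => WithLp.toLp 2 fun i => ι (x i)
  have hJ : ∀ x, ‖J x‖ = ‖x‖ := fun x => by simp [J, PiLp.norm_eq_of_L2]
  have hinner : ∀ x y, ⟪x, matrixOp (p.map (polyEval T)) y⟫_ℂ =
      ⟪J x, matrixOp (p.map (polyEval U)) (J y)⟫_ℂ := fun x y => by
    simp only [inner_matrixOp, Matrix.map_apply, hp, J]
  have : ‖matrixOp (p.map (polyEval T))‖ ≤ ‖matrixOp (p.map (polyEval U))‖ := by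
    refine ContinuousLinearMap.opNorm_le_of_re_inner_le (𝕜 := ℂ) (norm_nonneg _)
      fun x y hx hy => ?_
    rw [← inner_conj_symm, RCLike.conj_re, hinner]
    refine (re_inner_le_norm (𝕜 := ℂ) _ _).trans ?_
    rw [hJ, hy, one_mul]
    exact ContinuousLinearMap.unit_le_opNorm _ _ (by rw [hJ, hx])
  exact enorm_le_iff_norm_le.2 this

end Compression

/-! ### The torus as a boundary. -/

section MaximumPrinciple

theorem differentiable_eval_update {d : ℕ} (q : MvPolynomial (Fin d) ℂ) (z : Fin d → ℂ)
    (i : Fin d) : Differentiable ℂ fun t => q.eval (Function.update z i t) := by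
  induction q using MvPolynomial.induction_on with
  | C a => simp
  | add p q hp hq =>
    simp only [map_add]
    exact hp.add hq
  | mul_X p j hp =>
    have : Differentiable ℂ fun t : ℂ => Function.update z i t j := by
      rcases eq_or_ne j i with rfl | h
      · simp
      · simp [h]
    simp only [map_mul, MvPolynomial.eval_X]
    exact hp.mul this

/-- The maximum principle on the polydisc: the torus is a boundary for polynomials. -/
theorem norm_eval_le_of_forall_torus {d : ℕ} {q : MvPolynomial (Fin d) ℂ} {B : ℝ}
    (hq : ∀ z : Fin d → ℂ, (∀ i, ‖z i‖ = 1) → ‖q.eval z‖ ≤ B) :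
    ∀ z ∈ closedPolydisc d, ‖q.eval z‖ ≤ B := by
  -- Coordinates are released from the circle one at a time; s is the set of those already free.
  suffices h : ∀ s : Finset (Fin d), ∀ z ∈ closedPolydisc d, (∀ i ∉ s, ‖z i‖ = 1) →
      ‖q.eval z‖ ≤ B from fun z hz => h Finset.univ z hz (by simp)
  intro s
  induction s using Finset.induction_on with
  | empty => exact fun z _ h => hq z fun i => h i (by simp)
  | insert i s _ ih =>
    intro z hz h
    have h1 := Complex.norm_le_of_forall_mem_frontier_norm_le (C := B) (z := z i)
      (Metric.isBounded_ball (x := (0 : ℂ)) (r := 1))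
      (differentiable_eval_update q z i).diffContOnCl (fun t ht => ?_) ?_
    · simpa using h1
    · rw [frontier_ball _ one_ne_zero, mem_sphere_zero_iff_norm] at ht
      refine ih _ (fun j => ?_) fun j hj => ?_
      · rcases eq_or_ne j i with rfl | hji
        · simp [ht]
        · simpa [hji] using hz j
      · rcases eq_or_ne j i with rfl | hji
        · simp [ht]
        · simpa [hji] using h j (by simp [hji, hj])
    · rw [closure_ball _ one_ne_zero, mem_closedBall_zero_iff]
      exact hz i

end MaximumPrinciple

/-! ### Complete positivity of the polynomial calculus. -/

section Positivity

theorem inner_toEuclideanCLM_map_eval {d m : ℕ}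
    (p : Matrix (Fin m) (Fin m) (MvPolynomial (Fin d) ℂ)) (z : Fin d → ℂ)
    (v w : EuclideanSpace ℂ (Fin m)) :
    ⟪v, Matrix.toEuclideanCLM (𝕜 := ℂ) (n := Fin m) (p.map (MvPolynomial.eval z)) w⟫_ℂ =
      ∑ i, ∑ j, star (v i) * (p i j).eval z * w j := by
  simp [PiLp.inner_apply, Matrix.ofLp_toEuclideanCLM, Matrix.mulVec, dotProduct, Finset.sum_mul]
  refine Finset.sum_congr rfl fun i _ => Finset.sum_congr rfl fun j _ => by ring

variable {E : Type*} [NormedAddCommGroup E] [InnerProductSpace ℂ E]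

theorem norm_sub_smul_sq (x y : E) (ε : ℝ) :
    ‖x - (ε : ℂ) • y‖ ^ 2 = ‖x‖ ^ 2 - 2 * ε * (⟪x, y⟫_ℂ).re + ε ^ 2 * ‖y‖ ^ 2 := by
  rw [@norm_sub_sq ℂ, inner_smul_right, norm_smul, Complex.norm_real, mul_pow, Real.norm_eq_abs,
    sq_abs]
  simp
  ring

variable {H : Type u} [NormedAddCommGroup H] [InnerProductSpace ℂ H]

/-- The polynomial calculus is completely positive: if the real part of a matrix of polynomials
is positive semidefinite on the torus, then so is the real part of its value at the tuple. -/
theorem re_sum_inner_nonneg {d m : ℕ} {T : Fin d → H →L[ℂ] H}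
    (hcomm : ∀ i j, Commute (T i) (T j)) (h : MatrixVonNeumannInequality (closedPolydisc d) T)
    (p : Matrix (Fin m) (Fin m) (MvPolynomial (Fin d) ℂ))
    (hp : ∀ z : Fin d → ℂ, (∀ i, ‖z i‖ = 1) → ∀ v : Fin m → ℂ,
      0 ≤ (∑ i, ∑ j, star (v i) * (p i j).eval z * v j).re) (e : Fin m → H) :
    0 ≤ (∑ i, ∑ j, ⟪e i, polyEval T (p i j) (e j)⟫_ℂ).re := by
  obtain ⟨φ, -, hφ⟩ := exists_algHom_eq_polyEval hcomm
  obtain ⟨B, hB⟩ := exists_bound_eval p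
  obtain ⟨C, hC⟩ : ∃ C, ∀ z ∈ closedPolydisc d,
      ‖Matrix.toEuclideanCLM (𝕜 := ℂ) (n := Fin m) (p.map (MvPolynomial.eval z))‖ ≤ C :=
    ⟨_, fun z hz => norm_toEuclideanCLM_le _ fun i j => hB i j z hz⟩
  let x : PiLp 2 (fun _ : Fin m => H) := WithLp.toLp 2 e
  have hx : ∑ i, ∑ j, ⟪e i, polyEval T (p i j) (e j)⟫_ℂ =
      ⟪x, matrixOp (p.map (polyEval T)) x⟫_ℂ := by
    simp [inner_matrixOp, x]
  rw [hx]
  -- Re p ≥ 0 is the first-order content of ‖1 - εp‖² ≤ 1 + ε²C². This norm bound passes from the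
  -- torus to the polydisc to T; expanding the square, dividing by ε and letting ε → 0 recovers
  -- positivity.
  suffices hε : ∀ ε : ℝ, 0 < ε →
      -(C ^ 2 * ‖x‖ ^ 2) * ε ≤ 2 * (⟪x, matrixOp (p.map (polyEval T)) x⟫_ℂ).re by
    have hlim : Filter.Tendsto (fun ε : ℝ => -(C ^ 2 * ‖x‖ ^ 2) * ε)
        (nhdsWithin 0 (Set.Ioi 0)) (nhds 0) := by
      have : Continuous fun ε : ℝ => -(C ^ 2 * ‖x‖ ^ 2) * ε := by fun_prop
      simpa using (this.tendsto 0).mono_left nhdsWithin_le_nhds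
    have := le_of_tendsto hlim (eventually_nhdsWithin_of_forall hε)
    linarith
  intro ε hε
  let R : ℝ := Real.sqrt (1 + ε ^ 2 * C ^ 2)
  have hR0 : 0 ≤ R := Real.sqrt_nonneg _
  have hR : R ^ 2 = 1 + ε ^ 2 * C ^ 2 := Real.sq_sqrt (by positivity)
  let p' : Matrix (Fin m) (Fin m) (MvPolynomial (Fin d) ℂ) := 1 - (ε : ℂ) • p
  have hp'z : ∀ z, p'.map (MvPolynomial.eval z) = 1 - (ε : ℂ) • p.map (MvPolynomial.eval z) := by
    intro z
    ext1 i j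
    simp only [p', Matrix.map_apply, Matrix.sub_apply, Matrix.smul_apply, map_sub,
      MvPolynomial.smul_eval, smul_eq_mul]
    rcases eq_or_ne i j with rfl | hij <;> simp [*]
  have hp'T : p'.map (polyEval T) = 1 - (ε : ℂ) • p.map (polyEval T) := by
    ext1 i j
    simp only [p', Matrix.map_apply, Matrix.sub_apply, Matrix.smul_apply, ← hφ, map_sub, map_smul]
    rcases eq_or_ne i j with rfl | hij
    · simp only [Matrix.one_apply_eq, map_one]
    · simp only [Matrix.one_apply_ne hij, map_zero]
  have htorus : ∀ z : Fin d → ℂ, (∀ i, ‖z i‖ = 1) → ∀ v,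
      ‖Matrix.toEuclideanCLM (𝕜 := ℂ) (n := Fin m) (p'.map (MvPolynomial.eval z)) v‖ ≤
        R * ‖v‖ := by
    intro z hz v
    refine le_of_sq_le_sq ?_ (by positivity)
    rw [hp'z, map_sub, map_one, map_smul]
    have h1 : ‖v - (ε : ℂ) • Matrix.toEuclideanCLM (𝕜 := ℂ) (n := Fin m)
        (p.map (MvPolynomial.eval z)) v‖ ^ 2 ≤ (R * ‖v‖) ^ 2 := by
      rw [norm_sub_smul_sq, mul_pow, hR, inner_toEuclideanCLM_map_eval]
      have h2 := hp z hz v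
      have h3 := ContinuousLinearMap.le_of_opNorm_le _ (hC z fun i => (hz i).le) v
      have h4 := pow_le_pow_left₀ (norm_nonneg _) h3 2
      have h5 : 0 ≤ ε ^ 2 := sq_nonneg ε
      nlinarith [mul_nonneg hε.le h2, mul_le_mul_of_nonneg_left h4 h5]
    exact h1
  have hdisc : ∀ z ∈ closedPolydisc d,
      ‖Matrix.toEuclideanCLM (𝕜 := ℂ) (n := Fin m) (p'.map (MvPolynomial.eval z))‖ ≤ R := by
    intro z hz
    refine ContinuousLinearMap.opNorm_le_of_re_inner_le (𝕜 := ℂ) hR0 fun v w hv hw => ?_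
    rw [← inner_conj_symm, RCLike.conj_re]
    refine (RCLike.re_le_norm _).trans ?_
    -- For fixed vectors the matrix coefficient ⟨w, p'(z) v⟩ is a polynomial in z, so the scalar
    -- maximum principle applies.
    let q : MvPolynomial (Fin d) ℂ :=
      ∑ i, ∑ j, MvPolynomial.C (star (w i)) * p' i j * MvPolynomial.C (v j)
    have hq : ∀ z, q.eval z = ⟪w, Matrix.toEuclideanCLM (𝕜 := ℂ) (n := Fin m)
        (p'.map (MvPolynomial.eval z)) v⟫_ℂ := by
      intro z
      rw [inner_toEuclideanCLM_map_eval]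
      simp [q]
    rw [← hq]
    refine norm_eval_le_of_forall_torus (fun z hz => ?_) z hz
    rw [hq]
    refine (norm_inner_le_norm _ _).trans ?_
    simpa [hv, hw] using htorus z hz v
  have hnorm : ‖matrixOp (p'.map (polyEval T))‖ ≤ R := by
    have h1 : supNormOn (closedPolydisc d) (fun z => p'.map (MvPolynomial.eval z)) ≤
        ENNReal.ofReal R := iSup₂_le fun z hz => by
      rw [← ofReal_norm]
      exact ENNReal.ofReal_le_ofReal (hdisc z hz)
    have h2 := (h m p').trans h1
    rw [← ofReal_norm] at h2
    exact (ENNReal.ofReal_le_ofReal_iff hR0).1 h2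
  have h1 := ContinuousLinearMap.le_of_opNorm_le _ hnorm x
  have h2 : matrixOp (p'.map (polyEval T)) x =
      x - (ε : ℂ) • matrixOp (p.map (polyEval T)) x := by
    rw [hp'T, sub_eq_add_neg, ← neg_smul, matrixOp_add, matrixOp_one, matrixOp_smul]
    simp [sub_eq_add_neg]
  rw [h2] at h1
  have h3 := pow_le_pow_left₀ (norm_nonneg _) h1 2
  rw [norm_sub_smul_sq, mul_pow, hR] at h3
  have h4 : 0 ≤ ε ^ 2 * ‖matrixOp (p.map (polyEval T)) x‖ ^ 2 := by positivity
  refine le_of_mul_le_mul_left ?_ hε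
  nlinarith

end Positivity

/-! ### Extension of positive functionals. -/

section Extension

/-- The M. Riesz extension theorem for a positive functional on the range of a linear map. -/
theorem riesz_extension_range {V W : Type*} [AddCommGroup V] [Module ℝ V] [AddCommGroup W]
    [Module ℝ W] (s : PointedCone ℝ V) (L : W →ₗ[ℝ] V) (φ : W →ₗ[ℝ] ℝ)
    (hpos : ∀ w, L w ∈ s → 0 ≤ φ w) (hdom : ∀ v, ∃ w, L w + v ∈ s) :
    ∃ F : V →ₗ[ℝ] ℝ, (∀ w, F (L w) = φ w) ∧ ∀ v ∈ s, 0 ≤ F v := by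
  obtain ⟨g, hg⟩ := L.rangeRestrict.exists_rightInverse_of_surjective L.range_rangeRestrict
  have hg' : ∀ y : LinearMap.range L, L (g y) = y := fun y =>
    congrArg Subtype.val (LinearMap.congr_fun hg y)
  -- Both w and -w are mapped to 0, which lies in the cone. Hence φ descends to the range of L and
  -- the choice of section g is immaterial.
  have hker : ∀ w, L w = 0 → φ w = 0 := by
    intro w hw
    refine le_antisymm ?_ (hpos w (by rw [hw]; exact s.zero_mem))
    have := hpos (-w) (by rw [map_neg, hw, neg_zero]; exact s.zero_mem)
    simpa using this
  let f : V →ₗ.[ℝ] ℝ := { domain := LinearMap.range L, toFun := φ ∘ₗ g }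
  obtain ⟨F, hF, hFpos⟩ := riesz_extension s f
    (fun y hy => hpos _ (by rw [hg']; exact hy))
    (fun v => by
      obtain ⟨w, hw⟩ := hdom v
      exact ⟨⟨L w, ⟨w, rfl⟩⟩, hw⟩)
  refine ⟨F, fun w => ?_, hFpos⟩
  have h1 := hF ⟨L w, ⟨w, rfl⟩⟩
  have h2 := hker (g ⟨L w, ⟨w, rfl⟩⟩ - w) (by rw [map_sub, hg', sub_self])
  rw [map_sub, sub_eq_zero] at h2
  exact h1.trans h2

/-- The M. Riesz extension theorem for complex function spaces: a functional that is positive on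
a majorizing subspace, here the range of `L`, extends to a positive functional. -/
theorem exists_positive_extension {Ω W : Type*} [AddCommGroup W] [Module ℂ W]
    {V : Submodule ℂ (Ω → ℂ)} (L : W →ₗ[ℂ] V) (φ : W →ₗ[ℂ] ℂ)
    (hpos : ∀ w, (∀ x, 0 ≤ ((L w).1 x).re) → 0 ≤ (φ w).re)
    (hdom : ∀ v : V, ∃ w, ∀ x, ‖v.1 x‖ ≤ ((L w).1 x).re) :
    ∃ Λ : V →ₗ[ℂ] ℂ, (∀ w, Λ (L w) = φ w) ∧
      ∀ v : V, (∀ x, 0 ≤ (v.1 x).re) → 0 ≤ (Λ v).re := by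
  let s : PointedCone ℝ V :=
    { carrier := {v | ∀ x, 0 ≤ (v.1 x).re}
      add_mem' := fun {v w} hv hw x => by simpa using add_nonneg (hv x) (hw x)
      zero_mem' := fun x => by simp
      smul_mem' := fun c v hv x => by
        have : ((c • v : V).1 x).re = c.1 * (v.1 x).re := by
          change (c.1 • v.1 x).re = _
          rw [Complex.real_smul, Complex.re_ofReal_mul]
        rw [this]
        exact mul_nonneg c.2 (hv x) }
  obtain ⟨F, hFL, hFpos⟩ := riesz_extension_range s (L.restrictScalars ℝ)
    (Complex.reLm ∘ₗ φ.restrictScalars ℝ) hpos fun v => by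
      obtain ⟨w, hw⟩ := hdom v
      refine ⟨w, fun x => ?_⟩
      have h1 := neg_le_of_abs_le ((Complex.abs_re_le_norm (v.1 x)).trans (hw x))
      change 0 ≤ ((L w).1 x + v.1 x).re
      rw [Complex.add_re]
      linarith
  replace hFL : ∀ w, F (L w) = (φ w).re := hFL
  -- A complex functional is determined by its real part: Λ v = F v - i F(iv).
  refine ⟨Module.Dual.extendRCLike F, fun w => ?_, fun v hv => ?_⟩
  · rw [Module.Dual.extendRCLike_apply, ← map_smul, hFL, hFL]
    apply Complex.ext <;> simp
  · have := hFpos v hv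
    simpa [Module.Dual.extendRCLike_apply] using this

/-- A positive functional on a self-adjoint function space is hermitian. -/
theorem positive_functional_star {Ω : Type*} {V : Submodule ℂ (Ω → ℂ)} {Λ : V →ₗ[ℂ] ℂ}
    (hΛ : ∀ v : V, (∀ x, 0 ≤ (v.1 x).re) → 0 ≤ (Λ v).re) {v w : V}
    (h : ∀ x, w.1 x = star (v.1 x)) : Λ w = star (Λ v) := by
  have hz : ∀ u : V, (∀ x, (u.1 x).re = 0) → (Λ u).re = 0 := by
    intro u hu
    refine le_antisymm ?_ (hΛ u fun x => (hu x).ge)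
    have := hΛ (-u) fun x => by simp [hu x]
    simpa using this
  -- For w = conj v both w - v and i(w + v) are purely imaginary; they give the real and the
  -- imaginary part of the claim.
  have h1 := hz (w - v) fun x => by simp [h]
  have h2 := hz (Complex.I • (w + v)) fun x => by simp [h]
  rw [map_sub, Complex.sub_re, sub_eq_zero] at h1
  rw [map_smul, map_add] at h2
  simp only [smul_eq_mul, Complex.mul_re, Complex.I_re, Complex.I_im, Complex.add_re,
    Complex.add_im] at h2
  apply Complex.ext
  · simpa using h1
  · simp only [Complex.star_def, Complex.conj_im]
    linarith

end Extension

/-! ### Unitary groups on Hausdorff completions. -/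

section Completion

open UniformSpace in
/-- A group of linear isometries of a space with a positive semidefinite inner product becomes a
group of unitary operators on its Hausdorff completion. -/
theorem exists_unitary_completion {E : Type u} [AddCommGroup E] [Module ℂ E]
    (c : PreInnerProductSpace.Core ℂ E) {M : Type*} [Group M] (σ : M →* Module.End ℂ E)
    (hσ : ∀ g x y, c.inner (σ g x) (σ g y) = c.inner x y) :
    ∃ (K : Type u) (_ : NormedAddCommGroup K) (_ : InnerProductSpace ℂ K) (_ : CompleteSpace K)
      (j : E →ₗ[ℂ] K) (ρ : M →* (K →L[ℂ] K)), (∀ x y, ⟪j x, j y⟫_ℂ = c.inner x y) ∧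
        (∀ g x, ρ g (j x) = j (σ g x)) ∧ ∀ g, ρ g ∈ unitary (K →L[ℂ] K) := by
  let _ : SeminormedAddCommGroup E := @InnerProductSpace.Core.toSeminormedAddCommGroup ℂ E _ _ _ c
  let _ : InnerProductSpace ℂ E := InnerProductSpace.ofCore c
  have hinner : ∀ g (x y : E), ⟪σ g x, σ g y⟫_ℂ = ⟪x, y⟫_ℂ := hσ
  have hnorm : ∀ g (x : E), ‖σ g x‖ = ‖x‖ := fun g x => by
    rw [@norm_eq_sqrt_re_inner ℂ, hinner, ← @norm_eq_sqrt_re_inner ℂ]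
  let s : M → E →L[ℂ] E := fun g =>
    (σ g).mkContinuous 1 fun x => by rw [one_mul, hnorm]
  let j : E →L[ℂ] Completion E := Completion.toComplL
  have hmap : ∀ g (x : E), Completion.map (s g) x = (s g x : Completion E) := fun g x =>
    Completion.map_coe (s g).uniformContinuous x
  have hcont : ∀ g, Continuous (Completion.map (s g)) := fun g => Completion.continuous_map
  let r : M → Completion E →L[ℂ] Completion E := fun g =>
    { toFun := Completion.map (s g)
      map_add' := fun x y => by
        refine Completion.induction_on₂ x y (isClosed_eq ?_ ?_) fun a b => ?_
        · exact (hcont g).comp continuous_add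
        · exact ((hcont g).comp continuous_fst).add
            ((hcont g).comp continuous_snd)
        · rw [← Completion.coe_add, hmap, hmap, hmap, map_add, Completion.coe_add]
      map_smul' := fun a x => by
        refine Completion.induction_on x (isClosed_eq ?_ ?_) fun b => ?_
        · exact (hcont g).comp (continuous_const_smul a)
        · exact (hcont g).const_smul a
        · rw [← Completion.coe_smul, hmap, hmap, map_smul, Completion.coe_smul]
          rfl
      cont := (hcont g) }
  have hr : ∀ g (x : E), r g (x : Completion E) = (σ g x : E) := hmap
  have hext : ∀ f₁ f₂ : Completion E →L[ℂ] Completion E,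
      (∀ x : E, f₁ (x : Completion E) = f₂ (x : Completion E)) → f₁ = f₂ := fun f₁ f₂ h => by
    ext x
    exact Completion.induction_on x (isClosed_eq f₁.continuous f₂.continuous) h
  let ρ : M →* (Completion E →L[ℂ] Completion E) :=
    { toFun := r
      map_one' := hext _ _ fun x => by rw [hr, map_one]; rfl
      map_mul' := fun g h => hext _ _ fun x => by
        rw [mul_apply_eq_comp, hr, hr, hr, map_mul]; rfl }
  -- Invariance of the inner product gives this on the dense image of `E`; unitarity is then the
  -- group law.
  have hstar : ∀ g, star (ρ g) = ρ g⁻¹ := by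
    intro g
    rw [ContinuousLinearMap.star_eq_adjoint, eq_comm, ContinuousLinearMap.eq_adjoint_iff]
    intro x y
    refine Completion.induction_on₂ x y (isClosed_eq ?_ ?_) fun a b => ?_
    · exact ((ρ g⁻¹).continuous.comp continuous_fst).inner continuous_snd
    · exact continuous_fst.inner ((ρ g).continuous.comp continuous_snd)
    · change ⟪r g⁻¹ a, (b : Completion E)⟫_ℂ = ⟪(a : Completion E), r g b⟫_ℂ
      rw [hr, hr, Completion.inner_coe, Completion.inner_coe, ← hinner g]
      congr 1
      rw [← Module.End.mul_apply, ← map_mul, mul_inv_cancel, map_one, Module.End.one_apply]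
  refine ⟨Completion E, inferInstance, inferInstance, inferInstance, j.toLinearMap, ρ,
    fun x y => Completion.inner_coe x y, fun g x => hr g x, fun g => ?_⟩
  rw [Unitary.mem_iff, hstar, ← map_mul, ← map_mul, inv_mul_cancel, mul_inv_cancel, map_one]
  exact ⟨rfl, rfl⟩

end Completion

/-! ### Forms and sections over the torus. -/

section FunctionSpaces

/-- The diagonal quadratic form with coefficients `c`, evaluated at `a`. -/
def weight {ι : Type*} (a : ι → ℂ) : (ι →₀ ℝ) →ₗ[ℝ] ℝ :=
  Finsupp.linearCombination ℝ fun x => ‖a x‖ ^ 2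

theorem weight_single {ι : Type*} (a : ι → ℂ) (x : ι) (r : ℝ) :
    weight a (Finsupp.single x r) = r * ‖a x‖ ^ 2 := by
  simp [weight]

/-- Functions of `(z, a)` that are bounded by a diagonal quadratic form in `a`. -/
def boundedForms (Z ι : Type*) : Submodule ℂ (Z × (ι → ℂ) → ℂ) where
  carrier := {v | ∃ c, ∀ ω, ‖v ω‖ ≤ weight ω.2 c}
  add_mem' := by
    rintro v w ⟨c, hc⟩ ⟨e, he⟩
    refine ⟨c + e, fun ω => ?_⟩
    rw [map_add]
    exact (norm_add_le _ _).trans (add_le_add (hc ω) (he ω))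
  zero_mem' := ⟨0, fun ω => by simp⟩
  smul_mem' := by
    rintro k v ⟨c, hc⟩
    refine ⟨‖k‖ • c, fun ω => ?_⟩
    rw [map_smul, Pi.smul_apply, norm_smul]
    exact mul_le_mul_of_nonneg_left (hc ω) (norm_nonneg k)

/-- Functions of `(z, a)` whose square is bounded by a diagonal quadratic form in `a`. -/
def boundedSections (Z ι : Type*) : Submodule ℂ (Z × (ι → ℂ) → ℂ) where
  carrier := {F | ∃ c, ∀ ω, ‖F ω‖ ^ 2 ≤ weight ω.2 c}
  add_mem' := by
    rintro F G ⟨c, hc⟩ ⟨e, he⟩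
    refine ⟨(2 : ℝ) • (c + e), fun ω => ?_⟩
    rw [map_smul, map_add, smul_eq_mul, Pi.add_apply]
    have h1 := pow_le_pow_left₀ (norm_nonneg _) (norm_add_le (F ω) (G ω)) 2
    nlinarith [hc ω, he ω, sq_nonneg (‖F ω‖ - ‖G ω‖)]
  zero_mem' := ⟨0, fun ω => by simp⟩
  smul_mem' := by
    rintro k F ⟨c, hc⟩
    refine ⟨‖k‖ ^ 2 • c, fun ω => ?_⟩
    rw [map_smul, Pi.smul_apply, norm_smul, mul_pow]
    exact mul_le_mul_of_nonneg_left (hc ω) (by positivity)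

theorem star_mul_mem_boundedForms {Z ι : Type*} (F G : boundedSections Z ι) :
    (fun ω => star (F.1 ω) * G.1 ω) ∈ boundedForms Z ι := by
  obtain ⟨c, hc⟩ := F.2
  obtain ⟨e, he⟩ := G.2
  refine ⟨c + e, fun ω => ?_⟩
  rw [map_add, norm_mul, norm_star]
  nlinarith [hc ω, he ω, sq_nonneg (‖F.1 ω‖ - ‖G.1 ω‖), sq_nonneg (‖F.1 ω‖), sq_nonneg (‖G.1 ω‖)]

/-- The coordinate functions `(z, a) ↦ a x`. -/
def coordSection (Z : Type*) {ι : Type*} (x : ι) : boundedSections Z ι :=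
  ⟨fun ω => ω.2 x, Finsupp.single x 1, fun ω => by rw [weight_single, one_mul]⟩

/-- The multiplication operators by unimodular functions. -/
def unimodularMul (Z ι : Type*) :
    (Z × (ι → ℂ) → Circle) →* Module.End ℂ (boundedSections Z ι) where
  toFun g :=
    { toFun := fun F => ⟨fun ω => g ω * F.1 ω, by
        obtain ⟨c, hc⟩ := F.2
        exact ⟨c, fun ω => by rw [norm_mul, Circle.norm_coe, one_mul]; exact hc ω⟩⟩
      map_add' := fun F G => Subtype.ext (funext fun ω => mul_add _ _ _)
      map_smul' := fun k F => Subtype.ext (funext fun ω => mul_left_comm _ _ _) }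
  map_one' := by
    ext F ω
    simp
  map_mul' g h := by
    ext F ω
    simp [mul_assoc]

/-- The semi-inner product on functions that a positive functional on forms defines. -/
@[reducible] def functionalCore {Z ι : Type*} {Λ : boundedForms Z ι →ₗ[ℂ] ℂ}
    (hΛ : ∀ v : boundedForms Z ι, (∀ ω, 0 ≤ (v.1 ω).re) → 0 ≤ (Λ v).re) :
    PreInnerProductSpace.Core ℂ (boundedSections Z ι) where
  inner F G := Λ ⟨_, star_mul_mem_boundedForms F G⟩
  conj_inner_symm F G := (positive_functional_star hΛ fun ω => by simp [mul_comm]).symm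
  re_inner_nonneg F := hΛ _ fun ω => by
    simp only [Complex.star_def, ← Complex.normSq_eq_conj_mul_self, Complex.ofReal_re]
    exact Complex.normSq_nonneg _
  add_left F G J := by
    rw [← map_add]
    congr 1
    ext ω
    simp [add_mul]
  smul_left F G k := by
    rw [← smul_eq_mul, ← map_smul]
    congr 1
    ext ω
    simp [mul_assoc]

end FunctionSpaces

/-! ### Construction of the dilation. -/

section Dilation

/-- Finitely many indices occur in the support; e lists them without repetition. One e serves every
f, so the form in z and its value at T become the same m × m matrix expression. -/
theorem exists_sum_eq_sum_fin {ι M : Type*} [AddCommMonoid M] (w : ι × ι →₀ M) :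
    ∃ (m : ℕ) (e : Fin m → ι), Function.Injective e ∧ ∀ f : ι → ι → M → ℂ,
      (∀ x y, f x y 0 = 0) →
        w.sum (fun xy p => f xy.1 xy.2 p) = ∑ i, ∑ j, f (e i) (e j) (w (e i, e j)) := by
  classical
  let J : Finset ι := w.support.image Prod.fst ∪ w.support.image Prod.snd
  have hJ : w.support ⊆ J ×ˢ J := by
    intro xy h
    rw [Finset.mem_product]
    exact ⟨Finset.mem_union_left _ (Finset.mem_image_of_mem _ h),
      Finset.mem_union_right _ (Finset.mem_image_of_mem _ h)⟩
  refine ⟨J.card, fun i => J.equivFin.symm i,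
    Subtype.val_injective.comp J.equivFin.symm.injective, fun f hf => ?_⟩
  have h1 : ∀ g : ι → ℂ, ∑ i, g (J.equivFin.symm i) = ∑ x ∈ J, g x := fun g => by
    rw [← Finset.sum_coe_sort J g]
    exact J.equivFin.symm.sum_comp fun x : J => g x
  rw [Finsupp.sum_of_support_subset w hJ _ fun xy _ => hf _ _, Finset.sum_product,
    ← h1]
  exact Finset.sum_congr rfl fun i _ => (h1 fun y => f _ y (w (_, y))).symm

/-- The defects s(x + y) - s x - s y and s(cx) - c s x have norm 0. This is needed because x ↦ a_x
is not linear before null vectors are divided out. -/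
theorem exists_linearIsometry_of_inner_eq {H K : Type*} [NormedAddCommGroup H]
    [InnerProductSpace ℂ H] [NormedAddCommGroup K] [InnerProductSpace ℂ K] {s : H → K}
    (hs : ∀ x y, ⟪s x, s y⟫_ℂ = ⟪x, y⟫_ℂ) : ∃ ι : H →ₗᵢ[ℂ] K, ∀ x, ι x = s x := by
  refine ⟨{ toFun := s, map_add' := fun x y => ?_, map_smul' := fun c x => ?_,
            norm_map' := fun x => ?_ }, fun x => rfl⟩
  · rw [← sub_eq_zero, ← inner_self_eq_zero (𝕜 := ℂ)]
    simp only [inner_sub_left, inner_sub_right, inner_add_left, inner_add_right, hs]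
    ring
  · rw [← sub_eq_zero, ← inner_self_eq_zero (𝕜 := ℂ)]
    simp only [inner_sub_left, inner_sub_right, inner_smul_left, inner_smul_right, hs,
      RingHom.id_apply]
    ring
  · change ‖s x‖ = ‖x‖
    rw [@norm_eq_sqrt_re_inner ℂ, hs, ← @norm_eq_sqrt_re_inner ℂ]

variable {H : Type u} [NormedAddCommGroup H] [InnerProductSpace ℂ H]

theorem polyEval_monomial {d : ℕ} (T : Fin d → H →L[ℂ] H) (n : Fin d →₀ ℕ) :
    polyEval T (MvPolynomial.monomial n 1) = tuplePow T n := by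
  classical
  rw [polyEval, MvPolynomial.support_monomial, if_neg one_ne_zero, Finset.sum_singleton,
    MvPolynomial.coeff_monomial, if_pos rfl, one_smul]

/-- The polynomial calculus extends to a positive functional on forms over the torus. -/
theorem exists_positive_functional {d : ℕ} {T : Fin d → H →L[ℂ] H}
    (hcomm : ∀ i j, Commute (T i) (T j)) (h : MatrixVonNeumannInequality (closedPolydisc d) T) :
    ∃ Λ : boundedForms (Fin d → Circle) H →ₗ[ℂ] ℂ,
      (∀ v : boundedForms (Fin d → Circle) H, (∀ ω, 0 ≤ (v.1 ω).re) → 0 ≤ (Λ v).re) ∧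
        ∀ (x y : H) (n : Fin d → ℕ) (v : boundedForms (Fin d → Circle) H),
          (∀ ω, v.1 ω = star (ω.2 x) * (((∏ i, ω.1 i ^ n i : Circle) : ℂ) * ω.2 y)) →
            Λ v = ⟪x, tuplePow T n y⟫_ℂ := by
  obtain ⟨φ, -, hφ⟩ := exists_algHom_eq_polyEval hcomm
  let L₀ : (H × H →₀ MvPolynomial (Fin d) ℂ) →ₗ[ℂ] ((Fin d → Circle) × (H → ℂ) → ℂ) :=
    Finsupp.lsum ℂ fun xy =>
      { toFun := fun p ω => star (ω.2 xy.1) * p.eval (fun i => (ω.1 i : ℂ)) * ω.2 xy.2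
        map_add' := fun p q => by
          funext ω
          simp only [map_add, Pi.add_apply]
          ring
        map_smul' := fun c p => by
          funext ω
          simp only [MvPolynomial.smul_eval, Pi.smul_apply, smul_eq_mul, RingHom.id_apply]
          ring }
  have hL₀ : ∀ w ω, L₀ w ω =
      w.sum fun xy p => star (ω.2 xy.1) * p.eval (fun i => (ω.1 i : ℂ)) * ω.2 xy.2 := by
    intro w ω
    simp only [L₀, Finsupp.lsum_apply, Finsupp.sum, Finset.sum_apply]
    rfl
  have hL₀s : ∀ x y p ω, L₀ (Finsupp.single (x, y) p) ω =
      star (ω.2 x) * p.eval (fun i => (ω.1 i : ℂ)) * ω.2 y := by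
    intro x y p ω
    rw [hL₀, Finsupp.sum_single_index (by simp)]
  have hmem : ∀ w, L₀ w ∈ boundedForms (Fin d → Circle) H := by
    intro w
    induction w using Finsupp.induction_linear with
    | zero => rw [map_zero]; exact Submodule.zero_mem _
    | add w₁ w₂ h₁ h₂ => rw [map_add]; exact Submodule.add_mem _ h₁ h₂
    | single xy p =>
      obtain ⟨B, hB⟩ := exists_bound_eval (Matrix.of fun _ _ : Fin 1 => p)
      refine ⟨Finsupp.single xy.1 B + Finsupp.single xy.2 B, fun ω => ?_⟩
      have h1 := hB 0 0 (fun i => (ω.1 i : ℂ)) fun i => (Circle.norm_coe _).le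
      rw [Matrix.of_apply] at h1
      have h0 := (norm_nonneg _).trans h1
      rw [hL₀s, map_add, weight_single, weight_single, norm_mul, norm_mul, norm_star]
      have h2 := mul_le_mul_of_nonneg_right h1
        (mul_nonneg (norm_nonneg (ω.2 xy.1)) (norm_nonneg (ω.2 xy.2)))
      nlinarith [mul_nonneg h0 (sq_nonneg (‖ω.2 xy.1‖ - ‖ω.2 xy.2‖)),
        mul_nonneg h0 (sq_nonneg ‖ω.2 xy.1‖), mul_nonneg h0 (sq_nonneg ‖ω.2 xy.2‖)]
  let L := L₀.codRestrict (boundedForms (Fin d → Circle) H) hmem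
  let Φ : (H × H →₀ MvPolynomial (Fin d) ℂ) →ₗ[ℂ] ℂ :=
    Finsupp.lsum ℂ fun xy =>
      { toFun := fun p => ⟪xy.1, φ p xy.2⟫_ℂ
        map_add' := fun p q => by
          rw [map_add, _root_.add_apply, inner_add_right]
        map_smul' := fun c p => by
          rw [map_smul, _root_.smul_apply, inner_smul_right]
          rfl }
  have hΦ : ∀ w, Φ w = w.sum fun xy p => ⟪xy.1, φ p xy.2⟫_ℂ := fun w => rfl
  have hpos : ∀ w, (∀ ω, 0 ≤ ((L w).1 ω).re) → 0 ≤ (Φ w).re := by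
    intro w hw
    obtain ⟨m, e, he, hsum⟩ := exists_sum_eq_sum_fin w
    rw [hΦ, hsum (fun x y p => ⟪x, φ p y⟫_ℂ) (by simp)]
    simp only [hφ]
    refine re_sum_inner_nonneg hcomm h (Matrix.of fun i j => w (e i, e j)) (fun z hz v => ?_) e
    let ζ : Fin d → Circle := fun i => ⟨z i, mem_sphere_zero_iff_norm.2 (hz i)⟩
    -- Since the families a are arbitrary and e is injective, every vector v occurs as the values of
    -- some a along e.
    have h1 := hw (ζ, Function.extend e v 0)
    change 0 ≤ (L₀ w _).re at h1
    rw [hL₀, hsum (fun x y p => star (Function.extend e v 0 x) *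
      p.eval (fun i => (ζ i : ℂ)) * Function.extend e v 0 y) (by simp)] at h1
    simp only [he.extend_apply] at h1
    exact h1
  -- Diagonal forms come from constant polynomials on the diagonal, so the range of L majorizes all
  -- of `boundedForms`.
  have hdom : ∀ c : H →₀ ℝ, ∃ w, ∀ ω, (L w).1 ω = weight ω.2 c := by
    intro c
    induction c using Finsupp.induction_linear with
    | zero => exact ⟨0, fun ω => by simp⟩
    | add c₁ c₂ h₁ h₂ =>
      obtain ⟨w₁, h₁⟩ := h₁
      obtain ⟨w₂, h₂⟩ := h₂
      refine ⟨w₁ + w₂, fun ω => ?_⟩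
      rw [map_add, map_add, Complex.ofReal_add, ← h₁, ← h₂]
      rfl
    | single x r =>
      refine ⟨Finsupp.single (x, x) (MvPolynomial.C (r : ℂ)), fun ω => ?_⟩
      refine (hL₀s _ _ _ _).trans ?_
      rw [weight_single, MvPolynomial.eval_C, mul_right_comm, Complex.star_def,
        ← Complex.normSq_eq_conj_mul_self, Complex.normSq_eq_norm_sq, Complex.ofReal_mul, mul_comm]
  obtain ⟨Λ, hΛ, hΛpos⟩ := exists_positive_extension L Φ hpos fun v => by
    obtain ⟨c, hc⟩ := v.2
    obtain ⟨w, hw⟩ := hdom c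
    exact ⟨w, fun ω => by rw [hw, Complex.ofReal_re]; exact hc ω⟩
  refine ⟨Λ, hΛpos, fun x y n v hv => ?_⟩
  let n' : Fin d →₀ ℕ := Finsupp.equivFunOnFinite.symm n
  have h1 : v = L (Finsupp.single (x, y) (MvPolynomial.monomial n' 1)) := by
    refine Subtype.ext (funext fun ω => ?_)
    refine Eq.trans ?_ (hL₀s _ _ _ _).symm
    rw [hv, MvPolynomial.eval_monomial, Finsupp.prod_fintype _ _ (by simp), ← mul_assoc]
    have h2 : ((∏ i, ω.1 i ^ n i : Circle) : ℂ) = ∏ i, (ω.1 i : ℂ) ^ n i :=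
      map_prod Circle.coeHom _ _
    simp [n', h2]
  rw [h1, hΛ, hΦ, Finsupp.sum_single_index (by simp), hφ, polyEval_monomial]
  rfl

theorem hasUnitaryDilation_of_matrixVonNeumannInequality [CompleteSpace H] {d : ℕ}
    {T : Fin d → H →L[ℂ] H} (hcomm : ∀ i j, Commute (T i) (T j))
    (h : MatrixVonNeumannInequality (closedPolydisc d) T) : HasUnitaryDilation T := by
  obtain ⟨Λ, hΛpos, hΛ⟩ := exists_positive_functional hcomm h
  obtain ⟨K, _, _, _, j, ρ, hj, hρ, hunit⟩ := exists_unitary_completion (functionalCore hΛpos)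
    (unimodularMul (Fin d → Circle) H) fun g F G => by
      refine congrArg Λ (Subtype.ext (funext fun ω => ?_))
      have hg : star (g ω : ℂ) * g ω = 1 := by
        rw [Complex.star_def, ← Complex.normSq_eq_conj_mul_self]
        simp
      change star (g ω * F.1 ω) * (g ω * G.1 ω) = star (F.1 ω) * G.1 ω
      rw [star_mul', mul_mul_mul_comm, hg, one_mul]
  let χ : Fin d → (Fin d → Circle) × (H → ℂ) → Circle := fun i ω => ω.1 i
  have htuple : ∀ n : Fin d → ℕ, tuplePow (fun i => ρ (χ i)) n = ρ (∏ i, χ i ^ n i) := by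
    intro n
    rw [tuplePow, ← List.prod_ofFn, map_list_prod, List.map_ofFn]
    simp only [Function.comp_def, map_pow]
  have hinner : ∀ n x y, ⟪j (coordSection _ x), ρ (∏ i, χ i ^ n i) (j (coordSection _ y))⟫_ℂ =
      ⟪x, tuplePow T n y⟫_ℂ := by
    intro n x y
    rw [hρ, hj]
    refine hΛ x y n _ fun ω => ?_
    change star (ω.2 x) * (((∏ i, χ i ^ n i) ω : Circle) * ω.2 y) = _
    simp [χ, Finset.prod_apply]
  -- The exponent n = 0 of the dilation identity says that the embedding preserves inner products.
  obtain ⟨ι, hι⟩ := exists_linearIsometry_of_inner_eq (s := fun x : H => j (coordSection _ x))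
    fun x y => by
      have := hinner 0 x y
      simpa [tuplePow, List.ofFn_const] using this
  refine ⟨K, inferInstance, inferInstance, inferInstance, ι, fun i => ρ (χ i), fun i => hunit _,
    fun i j => ?_, fun n => ?_⟩
  · rw [commute_iff_eq, ← map_mul, ← map_mul, mul_comm]
  · ext y
    refine ext_inner_left ℂ fun x => ?_
    rw [htuple, ← hinner]
    simp [ContinuousLinearMap.adjoint_inner_right, hι]

end Dilation

end PolydiscDilation

end

theorem mainTheorem11 {H : Type u} [NormedAddCommGroup H] [InnerProductSpace ℂ H]
    [CompleteSpace H] (d : ℕ) (T : Fin d → H →L[ℂ] H)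
    (hcomm : ∀ i j, Commute (T i) (T j)) (hcontr : ∀ i, ‖T i‖ ≤ 1) :
    (PolydiscDilation.HasUnitaryDilation T ↔
      PolydiscDilation.IsCompleteSpectralSet (PolydiscDilation.closedPolydisc d) T) ∧
    (PolydiscDilation.IsCompleteSpectralSet (PolydiscDilation.closedPolydisc d) T ↔
      PolydiscDilation.MatrixVonNeumannInequality (PolydiscDilation.closedPolydisc d) T) := by
  have h23 := PolydiscDilation.isCompleteSpectralSet_of_matrixVonNeumannInequality hcomm hcontr
  refine ⟨⟨fun h => h23 (PolydiscDilation.matrixVonNeumannInequality_of_hasUnitaryDilation h),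
    fun h => PolydiscDilation.hasUnitaryDilation_of_matrixVonNeumannInequality hcomm
      (PolydiscDilation.matrixVonNeumannInequality_of_isCompleteSpectralSet h)⟩,
    PolydiscDilation.matrixVonNeumannInequality_of_isCompleteSpectralSet, h23⟩
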